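/- Let $n\ge 0$ and, for every $\hbar>0$, let $\Theta(\hbar)$ and $N(\hbar)$ be real antisymmetric $n\times n$ matrices with $\Theta(\hbar)=o(\hbar^2)$ and $N(\hbar)=o(\hbar^2)$ (entrywise) as $\hbar\to0^+$. Put $$\Omega=\Omega(\hbar)=\begin{pmatrix}\hbar^{-1}\Theta(\hbar)&I\\-I&\hbar^{-1}N(\hbar)\end{pmatrix}.$$ For $a,b\in\mathcal S(\mathbb R^{2n})$ (complex-valued Schwartz functions of $z=(x,p)$) the $\Omega$-starproduct is $a\star_\Omega b=\widetilde A_\Omega b$, where $\widetilde A_\Omega$ is the operator on functions on $\mathbb R^{2n}$ with Weyl symbol $\widetilde a_\Omega(z,\zeta)=a(z-\tfrac12\Omega\zeta)$, that is $$(a\star_\Omega b)(z)=\Big(\frac1{2\pi\hbar}\Big)^{2n}\int_{\mathbb R^{2n}}\int_{\mathbb R^{2n}}e^{\frac i\hbar\zeta\cdot(z-u)}\,a\big(\tfrac12(z+u)-\tfrac12\Omega\zeta\big)\,b(u)\,du\,d\zeta .$$ Let $\{a,b\}=\sum_{\alpha=1}^n\big(\partial_{x_\alpha}a\,\partial_{p_\alpha}b-\partial_{p_\alpha}a\,\partial_{x_\alpha}b\big)$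 be the standard Poisson bracket. Then, for all $a,b\in\mathcal S(\mathbb R^{2n})$: for all sufficiently small $\hbar>0$ the matrix $\Omega$ is invertible and the integrals defining $a\star_\Omega b$ and $b\star_\Omega a$ converge absolutely at every $z$, and $$a\star_\Omega b-b\star_\Omega a=i\hbar\{a,b\}+O(\hbar^2)\qquad(\hbar\to0^+),$$ where $O(\hbar^2)$ is meant in the topology of $\mathcal S(\mathbb R^{2n})$: the remainder is a Schwartz function $R_\hbar$ for all sufficiently small $\hbar>0$, and every Schwartz seminorm of $R_\hbar$ is $O(\hbar^2)$. -/

import Mathlib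

open scoped SchwartzMap Topology

noncomputable section

/-- The phase space `ℝ²ⁿ` with its Euclidean structure. A point is `z = (x, p)`: the coordinates
`Sum.inl α` are the positions `x_α`, the coordinates `Sum.inr α` are the momenta `p_α`. -/
abbrev PhaseSpace (n : ℕ) : Type := EuclideanSpace ℝ (Fin n ⊕ Fin n)

/-- The block matrix `Ω = [[ħ⁻¹ Θ, I], [-I, ħ⁻¹ N]]`. -/
def omegaMatrix {n : ℕ} (ħ : ℝ) (Θ N : Matrix (Fin n) (Fin n) ℝ) :
    Matrix (Fin n ⊕ Fin n) (Fin n ⊕ Fin n) ℝ :=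
  Matrix.fromBlocks (ħ⁻¹ • Θ) 1 (-1) (ħ⁻¹ • N)

/-- The integrand `e^{(i/ħ) ζ·(z-u)} A((z+u)/2, ζ) Ψ(u)`, as a function of `(u, ζ)`, of the Weyl
quantization on `ℝᵐ` of a symbol `A(z, ζ)`, applied to `Ψ` and evaluated at `z`. -/
def weylIntegrand {ι : Type*} [Fintype ι] (ħ : ℝ)
    (A : EuclideanSpace ℝ ι → EuclideanSpace ℝ ι → ℂ) (Ψ : EuclideanSpace ℝ ι → ℂ)
    (z : EuclideanSpace ℝ ι) (q : EuclideanSpace ℝ ι × EuclideanSpace ℝ ι) : ℂ :=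
  Complex.exp (Complex.I * ((inner ℝ q.2 (z - q.1) / ħ : ℝ) : ℂ)) *
    A ((1 / 2 : ℝ) • (z + q.1)) q.2 * Ψ q.1

/-- The operator with Weyl symbol `A(z, ζ)` on `ℝᵐ`:
`(Op A) Ψ (z) = (2πħ)⁻ᵐ ∫∫ e^{(i/ħ) ζ·(z-u)} A((z+u)/2, ζ) Ψ(u) du dζ`. -/
def weylOperator {ι : Type*} [Fintype ι] (ħ : ℝ)
    (A : EuclideanSpace ℝ ι → EuclideanSpace ℝ ι → ℂ) (Ψ : EuclideanSpace ℝ ι → ℂ)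
    (z : EuclideanSpace ℝ ι) : ℂ :=
  (((1 / (2 * Real.pi * ħ)) ^ Fintype.card ι : ℝ) : ℂ) *
    ∫ q : EuclideanSpace ℝ ι × EuclideanSpace ℝ ι, weylIntegrand ħ A Ψ z q

/-- The symbol `ã_Ω(z, ζ) = a(z - ½ Ω ζ)` on `ℝ²ⁿ ⊕ ℝ²ⁿ`. -/
def starSymbol {n : ℕ} (Ω : Matrix (Fin n ⊕ Fin n) (Fin n ⊕ Fin n) ℝ)
    (a : PhaseSpace n → ℂ) (z ζ : PhaseSpace n) : ℂ :=
  a (z - (1 / 2 : ℝ) • Matrix.toEuclideanLin Ω ζ)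

/-- The integral that defines `(a ⋆_Ω b)(z)` converges absolutely at every point `z`. -/
def StarConverges {n : ℕ} (ħ : ℝ) (Ω : Matrix (Fin n ⊕ Fin n) (Fin n ⊕ Fin n) ℝ)
    (a b : PhaseSpace n → ℂ) : Prop :=
  ∀ z, MeasureTheory.Integrable (weylIntegrand ħ (starSymbol Ω a) b z)

/-- The `Ω`-starproduct `a ⋆_Ω b = Ã_Ω b`, where `Ã_Ω` is the operator on functions on phase space
with Weyl symbol `ã_Ω`. -/
def omegaStar {n : ℕ} (ħ : ℝ) (Ω : Matrix (Fin n ⊕ Fin n) (Fin n ⊕ Fin n) ℝ)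
    (a b : PhaseSpace n → ℂ) : PhaseSpace n → ℂ :=
  weylOperator ħ (starSymbol Ω a) b

/-- The standard Poisson bracket `{a, b} = ∑_α (∂_{x_α} a ∂_{p_α} b - ∂_{p_α} a ∂_{x_α} b)`. -/
def poissonBracket {n : ℕ} (a b : PhaseSpace n → ℂ) (z : PhaseSpace n) : ℂ :=
  ∑ α : Fin n,
    (fderiv ℝ a z (EuclideanSpace.single (Sum.inl α) 1) *
        fderiv ℝ b z (EuclideanSpace.single (Sum.inr α) 1) -
      fderiv ℝ a z (EuclideanSpace.single (Sum.inr α) 1) *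
        fderiv ℝ b z (EuclideanSpace.single (Sum.inl α) 1))

end

open scoped ContDiff FourierTransform

/-! Because `Ω` is antisymmetric and invertible, a linear change of variables turns the Weyl
integral into a twisted convolution in frequency space (`weylOperator_affine_eq`, then
`weylOperator_affine_eq_taylor`): the star product is the pointwise product `a b` with its double
Fourier integral in `(η, κ)` multiplied by `exp(iħ · 2π² κ·Ωη)`.

Expanding this factor as `1 + is + s²φ(s)` gives `a b`, a first-order bidifferential term, and `ħ²`
times a remainder. Since `φ` has bounded derivatives, the remainder multiplier has temperate growth
jointly in the frequencies and in `(Ω, ħ)`. As `Ω` converges to the standard symplectic matrix, `(Ω,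
ħ)` stays bounded, so the remainder is bounded in every Schwartz seminorm
(`schwartzIsBigO_starRemainder`).

In the commutator `a b` cancels and the antisymmetric first-order term doubles. The off-diagonal
blocks of `Ω` yield `iħ{a,b}`. The diagonal blocks contribute `-iΘ` and `-iN` times products of
derivatives, since the factor `ħ` cancels `ħ⁻¹`; these are `O(ħ²)` by assumption. -/

/-! ### Second-order Taylor remainder of the exponential -/

theorem exists_hasTemperateGrowth_exp_taylor :
    ∃ φ : ℝ → ℂ, φ.HasTemperateGrowth ∧ ∀ s : ℝ,
      Complex.exp (Complex.I * s) = 1 + Complex.I * s + (s : ℂ) ^ 2 * φ s := by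
  -- The integral form of the remainder is `φ s = -∫₀¹ (1 - t) e^{ist} dt`, the Fourier transform of
  -- a compactly supported function at `-s/(2π)`. Its derivatives are Fourier transforms of
  -- integrable functions, hence bounded.
  let f : ℝ → ℂ := Set.indicator (Set.Ioc 0 1) (fun v : ℝ => -(1 - (v : ℂ)))
  have hind (n : ℕ) : (fun v : ℝ => v ^ n • f v) =
      Set.indicator (Set.Ioc 0 1) (fun v : ℝ => v ^ n • (-(1 - (v : ℂ)))) := by
    ext v
    by_cases hv : v ∈ Set.Ioc (0 : ℝ) 1 <;> simp [f, hv]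
  have hint (n : ℕ) : MeasureTheory.Integrable (fun v : ℝ => v ^ n • f v) := by
    rw [hind, MeasureTheory.integrable_indicator_iff measurableSet_Ioc]
    exact (Continuous.integrableOn_Icc (by fun_prop)).mono_set Set.Ioc_subset_Icc_self
  have hcont : ContDiff ℝ ∞ (𝓕 f) := by
    refine Real.contDiff_fourier (N := ⊤) fun n _ => ?_
    simpa [norm_smul] using (hint n).norm
  have hF : (𝓕 f).HasTemperateGrowth := by
    refine ⟨hcont, fun n => ?_⟩
    refine ⟨0, ∫ v : ℝ, ‖(-2 * Real.pi * Complex.I * v) ^ n • f v‖, fun x => ?_⟩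
    rw [norm_iteratedFDeriv_eq_norm_iteratedDeriv,
      Real.iteratedDeriv_fourier (N := ⊤) (fun n _ => hint n) (by simp)]
    simp only [pow_zero, mul_one]
    exact VectorFourier.norm_fourierIntegral_le_integral_norm _ _ _ _ _
  refine ⟨fun s => 𝓕 f (-(2 * Real.pi)⁻¹ * s), ?_, fun s => ?_⟩
  · have h : (fun s : ℝ => -(2 * Real.pi)⁻¹ * s).HasTemperateGrowth := by fun_prop
    exact hF.comp h
  · have hFs : 𝓕 f (-(2 * Real.pi)⁻¹ * s) =
        ∫ t in (0 : ℝ)..1, Complex.exp (Complex.I * s * t) * (-(1 - (t : ℂ))) := by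
      rw [Real.fourier_eq', intervalIntegral.integral_of_le zero_le_one,
        ← MeasureTheory.integral_indicator measurableSet_Ioc]
      congr 1 with v
      by_cases hv : v ∈ Set.Ioc (0 : ℝ) 1
      · simp only [f, hv, Set.indicator_of_mem, smul_eq_mul]
        congr 2
        simp only [RCLike.inner_apply, conj_trivial]
        push_cast
        have : (Real.pi : ℂ) ≠ 0 := by exact_mod_cast Real.pi_ne_zero
        field_simp
      · simp [f, hv]
    -- This primitive equals `e^{is}` at `t = 1` and `1 + is` at `t = 0`.
    have hderiv (t : ℝ) : HasDerivAt (fun t : ℝ => Complex.exp (Complex.I * s * t) *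
        (1 + (1 - (t : ℂ)) * (Complex.I * s)))
        ((s : ℂ) ^ 2 * (Complex.exp (Complex.I * s * t) * (-(1 - (t : ℂ))))) t := by
      have h1 : HasDerivAt (fun t : ℝ => (t : ℂ)) 1 t := Complex.ofRealCLM.hasDerivAt
      have h2 := (h1.const_mul (Complex.I * s)).cexp
      have h3 := ((h1.const_sub 1).mul_const (Complex.I * s)).const_add 1
      refine (h2.mul h3).congr_deriv ?_
      linear_combination
        (-(s : ℂ) ^ 2 * Complex.exp (Complex.I * s * t) * (-(1 - (t : ℂ)))) * Complex.I_sq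
    have hftc := intervalIntegral.integral_eq_sub_of_hasDerivAt (a := 0) (b := 1)
      (fun t _ => hderiv t) (Continuous.intervalIntegrable (by fun_prop) _ _)
    rw [intervalIntegral.integral_const_mul] at hftc
    beta_reduce
    rw [hFs, hftc]
    simp

/-! ### Multipliers depending on a parameter -/

section

variable {E P : Type*} [NormedAddCommGroup E] [NormedSpace ℝ E]
  [NormedAddCommGroup P] [NormedSpace ℝ P]

theorem norm_iteratedFDeriv_slice_le {m : E × P → ℂ} (hm : ContDiff ℝ ∞ m) (l : ℕ) (p : P)
    (x : E) : ‖iteratedFDeriv ℝ l (fun x => m (x, p)) x‖ ≤ ‖iteratedFDeriv ℝ l m (x, p)‖ := by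
  have h : (fun x => m (x, p)) =
      (fun y => m (y + (0, p))) ∘ ContinuousLinearMap.inl ℝ E P := by
    ext x; simp
  rw [h, ContinuousLinearMap.iteratedFDeriv_comp_right (n := ∞) _ (by fun_prop) _ (mod_cast le_top),
    iteratedFDeriv_comp_add_right]
  refine (ContinuousMultilinearMap.norm_compContinuousLinearMap_le _ _).trans ?_
  simp only [ContinuousLinearMap.inl_apply, Prod.mk_add_mk, add_zero, zero_add]
  refine mul_le_of_le_one_right (norm_nonneg _) ?_
  exact Finset.prod_le_one (fun _ _ => norm_nonneg _)
    fun _ _ => ContinuousLinearMap.norm_inl_le_one ℝ E P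

/-- Source of all uniformity in `ħ`: joint temperate growth bounds the `x`-derivatives of every
slice by the same power of `1 + ‖x‖` while `p` stays bounded, and the decay of `F` absorbs that
power. -/
theorem SchwartzMap.exists_seminorm_smulLeftCLM_slice_le {m : E × P → ℂ}
    (hm : m.HasTemperateGrowth) (F : 𝓢(E, ℂ)) (r : ℝ) (k l : ℕ) :
    ∃ C : ℝ, ∀ p : P, ‖p‖ ≤ r →
      SchwartzMap.seminorm ℝ k l (SchwartzMap.smulLeftCLM ℂ (fun x => m (x, p)) F) ≤ C := by
  obtain ⟨d, A, hA, hmA⟩ := hm.norm_iteratedFDeriv_le_uniform l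
  -- The weight `d + k` pays for `‖x‖ ^ k` and for the growth of order `d` of the multiplier.
  let S : ℝ := 2 ^ (d + k) * (Finset.Iic (d + k, l)).sup
    (fun j => SchwartzMap.seminorm ℝ j.1 j.2) F
  have hS : 0 ≤ S := by positivity
  refine ⟨∑ i ∈ Finset.range (l + 1), (l.choose i : ℝ) * (A * (1 + |r|) ^ d) * S, fun p hp => ?_⟩
  have hslice : (fun x => m (x, p)).HasTemperateGrowth :=
    hm.comp (f := fun x : E => (x, p)) (by
      have h : (fun x : E => (x, p)) =
        fun x => ContinuousLinearMap.inl ℝ E P x + ((0 : E), p) := by ext x <;> simp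
      rw [h]; fun_prop)
  refine SchwartzMap.seminorm_le_bound _ _ _ _ (by positivity) fun x => ?_
  rw [SchwartzMap.smulLeftCLM_apply hslice]
  simp only [smul_eq_mul]
  grw [norm_iteratedFDeriv_mul_le hslice.1 (F.smooth ⊤) x (mod_cast le_top)]
  rw [Finset.mul_sum]
  refine Finset.sum_le_sum fun i hi => ?_
  have hi' : i ≤ l := Finset.mem_range_succ_iff.mp hi
  have h1 : ‖iteratedFDeriv ℝ i (fun x => m (x, p)) x‖ ≤
      A * (1 + |r|) ^ d * (1 + ‖x‖) ^ d := by
    refine (norm_iteratedFDeriv_slice_le hm.1 i p x).trans ((hmA i hi' _).trans ?_)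
    rw [mul_assoc, ← mul_pow]
    have : ‖(x, p)‖ ≤ ‖x‖ + |r| := by
      refine (max_le_add_of_nonneg (norm_nonneg _) (norm_nonneg _)).trans ?_
      grw [hp, ← le_abs_self]
    gcongr
    nlinarith [norm_nonneg x, abs_nonneg r]
  have h2 := SchwartzMap.one_add_le_sup_seminorm_apply (𝕜 := ℝ) (m := (d + k, l)) (k := d + k)
    (n := l - i) le_rfl (Nat.sub_le _ _) F x
  calc ‖x‖ ^ k * ((l.choose i : ℝ) * ‖iteratedFDeriv ℝ i (fun x => m (x, p)) x‖ *
        ‖iteratedFDeriv ℝ (l - i) F x‖)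
      ≤ (1 + ‖x‖) ^ k * ((l.choose i : ℝ) * (A * (1 + |r|) ^ d * (1 + ‖x‖) ^ d) *
        ‖iteratedFDeriv ℝ (l - i) F x‖) := by
        gcongr
        linarith
    _ = (l.choose i : ℝ) * (A * (1 + |r|) ^ d) *
        ((1 + ‖x‖) ^ (d + k) * ‖iteratedFDeriv ℝ (l - i) F x‖) := by ring
    _ ≤ (l.choose i : ℝ) * (A * (1 + |r|) ^ d) * S := by gcongr

end

/-! ### Calculus of `O(g)` in the Schwartz topology -/

section

variable {E F : Type*} [NormedAddCommGroup E] [NormedSpace ℝ E] [NormedAddCommGroup F]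
  [NormedSpace ℝ F]

/-- A family of Schwartz functions all of whose seminorms are bounded by a common function. -/
def SchwartzIsBigO {α : Type*} (R : α → 𝓢(E, ℂ)) (l : Filter α) (g : α → ℝ) : Prop :=
  ∀ i j : ℕ, (fun t => SchwartzMap.seminorm ℝ i j (R t)) =O[l] g

variable {α : Type*} {l : Filter α} {g : α → ℝ}

/-- Continuity of `T` bounds each seminorm of `T (R t)` by finitely many seminorms of `R t`. -/
theorem SchwartzIsBigO.map {R : α → 𝓢(E, ℂ)} (h : SchwartzIsBigO R l g)
    (T : 𝓢(E, ℂ) →L[ℂ] 𝓢(F, ℂ)) : SchwartzIsBigO (fun t => T (R t)) l g := by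
  intro i j
  have hcont : Continuous
      ((SchwartzMap.seminorm ℝ i j).comp (T.restrictScalars ℝ).toLinearMap) :=
    ((schwartz_withSeminorms ℝ F ℂ).continuous_seminorm (i, j)).comp T.continuous
  obtain ⟨s, C, -, hC⟩ := Seminorm.bound_of_continuous (schwartz_withSeminorms ℝ E ℂ) _ hcont
  refine Asymptotics.IsBigO.trans (g := fun t => ∑ q ∈ s, schwartzSeminormFamily ℝ E ℂ q (R t))
    ?_ (Asymptotics.IsBigO.fun_sum fun (q : ℕ × ℕ) _ => h q.1 q.2)
  refine Asymptotics.IsBigO.of_bound C (Filter.Eventually.of_forall fun t => ?_)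
  have h1 := hC (R t)
  have h2 : (s.sup (schwartzSeminormFamily ℝ E ℂ)) (R t) ≤
      ∑ q ∈ s, schwartzSeminormFamily ℝ E ℂ q (R t) :=
    Seminorm.finset_sup_apply_le (Finset.sum_nonneg fun _ _ => apply_nonneg _ _) fun q hq =>
      Finset.single_le_sum (f := fun q => schwartzSeminormFamily ℝ E ℂ q (R t))
        (fun _ _ => apply_nonneg _ _) hq
  rw [Real.norm_of_nonneg (apply_nonneg _ _),
    Real.norm_of_nonneg (Finset.sum_nonneg fun _ _ => apply_nonneg _ _)]
  refine h1.trans ?_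
  exact mul_le_mul_of_nonneg_left h2 C.coe_nonneg

theorem SchwartzIsBigO.add {R S : α → 𝓢(E, ℂ)} (hR : SchwartzIsBigO R l g)
    (hS : SchwartzIsBigO S l g) : SchwartzIsBigO (fun t => R t + S t) l g := by
  intro i j
  refine (Asymptotics.IsBigO.of_bound 1 (Filter.Eventually.of_forall fun t => ?_)).trans
    ((hR i j).norm_left.add (hS i j).norm_left)
  rw [Real.norm_of_nonneg (apply_nonneg _ _), Real.norm_of_nonneg (apply_nonneg _ _),
    Real.norm_of_nonneg (apply_nonneg _ _), Real.norm_of_nonneg (by positivity), one_mul]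
  exact map_add_le_add _ _ _

theorem SchwartzIsBigO.zero : SchwartzIsBigO (fun _ : α => (0 : 𝓢(E, ℂ))) l g := by
  intro i j
  simpa using Asymptotics.isBigO_zero g l

theorem SchwartzIsBigO.sum {ι : Type*} {s : Finset ι} {R : ι → α → 𝓢(E, ℂ)}
    (hR : ∀ q ∈ s, SchwartzIsBigO (R q) l g) : SchwartzIsBigO (fun t => ∑ q ∈ s, R q t) l g := by
  classical
  induction s using Finset.induction_on with
  | empty => simpa using SchwartzIsBigO.zero
  | insert a s ha ih =>
    simp only [Finset.sum_insert ha]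
    exact (hR a (by simp)).add (ih fun q hq => hR q (by simp [hq]))

theorem seminorm_complex_smul (i j : ℕ) (c : ℂ) (f : 𝓢(E, ℂ)) :
    SchwartzMap.seminorm ℝ i j (c • f) = ‖c‖ * SchwartzMap.seminorm ℝ i j f :=
  map_smul_eq_mul (SchwartzMap.seminorm ℂ i j) c f

theorem SchwartzIsBigO.smul {R : α → 𝓢(E, ℂ)} {c : α → ℂ} {c' : α → ℝ}
    (hc : c =O[l] c') (hR : SchwartzIsBigO R l g) :
    SchwartzIsBigO (fun t => c t • R t) l (fun t => c' t * g t) := by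
  intro i j
  simp only [seminorm_complex_smul]
  exact hc.norm_left.mul (hR i j)

theorem SchwartzIsBigO.of_bounded {R : α → 𝓢(E, ℂ)}
    (h : ∀ i j : ℕ, ∃ C : ℝ, ∀ᶠ t in l, SchwartzMap.seminorm ℝ i j (R t) ≤ C) :
    SchwartzIsBigO R l (fun _ => 1) := by
  intro i j
  obtain ⟨C, hC⟩ := h i j
  refine Asymptotics.IsBigO.of_bound C (hC.mono fun t ht => ?_)
  rw [Real.norm_of_nonneg (apply_nonneg _ _)]
  simpa using ht

end

/-! ### Tensor products and restriction to the diagonal -/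

section

variable {V : Type*} [NormedAddCommGroup V] [InnerProductSpace ℝ V]

theorem norm_iteratedFDeriv_comp_clm_le {E F : Type*} [NormedAddCommGroup E] [NormedSpace ℝ E]
    [NormedAddCommGroup F] [NormedSpace ℝ F] {f : F → ℂ} (hf : ContDiff ℝ ∞ f) (T : E →L[ℝ] F)
    (hT : ‖T‖ ≤ 1) (l : ℕ) (x : E) :
    ‖iteratedFDeriv ℝ l (fun x => f (T x)) x‖ ≤ ‖iteratedFDeriv ℝ l f (T x)‖ := by
  change ‖iteratedFDeriv ℝ l (f ∘ T) x‖ ≤ _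
  rw [ContinuousLinearMap.iteratedFDeriv_comp_right (n := ∞) _ hf _ (mod_cast le_top)]
  refine (ContinuousMultilinearMap.norm_compContinuousLinearMap_le _ _).trans ?_
  exact mul_le_of_le_one_right (norm_nonneg _) (Finset.prod_le_one (fun _ _ => norm_nonneg _)
    fun _ _ => hT)

/-- The tensor product `(η, κ) ↦ f η * g κ` of two Schwartz functions. -/
noncomputable def SchwartzMap.tensor (f g : 𝓢(V, ℂ)) : 𝓢(WithLp 2 (V × V), ℂ) where
  toFun x := f x.fst * g x.snd
  smooth' := by
    have h1 : ContDiff ℝ ∞ fun x : WithLp 2 (V × V) => f x.fst :=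
      (f.smooth ⊤).comp (WithLp.fstL 2 ℝ V V).contDiff
    have h2 : ContDiff ℝ ∞ fun x : WithLp 2 (V × V) => g x.snd :=
      (g.smooth ⊤).comp (WithLp.sndL 2 ℝ V V).contDiff
    exact h1.mul h2
  decay' k l := by
    have hfst : ‖WithLp.fstL 2 ℝ V V‖ ≤ 1 :=
      ContinuousLinearMap.opNorm_le_bound _ zero_le_one fun x => by
        simpa using WithLp.norm_fst_le V x
    have hsnd : ‖WithLp.sndL 2 ℝ V V‖ ≤ 1 :=
      ContinuousLinearMap.opNorm_le_bound _ zero_le_one fun x => by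
        simpa using WithLp.norm_snd_le V x
    have hf : ContDiff ℝ ∞ fun x : WithLp 2 (V × V) => f x.fst :=
      (f.smooth ⊤).comp (WithLp.fstL 2 ℝ V V).contDiff
    have hg : ContDiff ℝ ∞ fun x : WithLp 2 (V × V) => g x.snd :=
      (g.smooth ⊤).comp (WithLp.sndL 2 ℝ V V).contDiff
    let S : 𝓢(V, ℂ) → ℝ := fun h => 2 ^ k * (Finset.Iic (k, l)).sup
      (fun j => SchwartzMap.seminorm ℝ j.1 j.2) h
    have hS (h : 𝓢(V, ℂ)) : 0 ≤ S h := by positivity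
    refine ⟨∑ i ∈ Finset.range (l + 1), (l.choose i : ℝ) * S f * S g, fun x => ?_⟩
    grw [norm_iteratedFDeriv_mul_le hf hg x (mod_cast le_top)]
    rw [Finset.mul_sum]
    refine Finset.sum_le_sum fun i hi => ?_
    have hi' : i ≤ l := Finset.mem_range_succ_iff.mp hi
    have h1 := norm_iteratedFDeriv_comp_clm_le (f.smooth ⊤) _ hfst i x
    have h2 := norm_iteratedFDeriv_comp_clm_le (g.smooth ⊤) _ hsnd (l - i) x
    have h3 := SchwartzMap.one_add_le_sup_seminorm_apply (𝕜 := ℝ) (m := (k, l)) (k := k)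
      (n := i) le_rfl hi' f x.fst
    have h4 := SchwartzMap.one_add_le_sup_seminorm_apply (𝕜 := ℝ) (m := (k, l)) (k := k)
      (n := l - i) le_rfl (Nat.sub_le _ _) g x.snd
    -- Splits the weight into one factor for `f` and one for `g`.
    have h5 : ‖x‖ ≤ (1 + ‖x.fst‖) * (1 + ‖x.snd‖) := by
      rw [WithLp.prod_norm_eq_of_L2]
      refine Real.sqrt_le_iff.mpr ⟨by positivity, ?_⟩
      have := norm_nonneg x.fst
      have := norm_nonneg x.snd
      have : 0 ≤ ‖x.fst‖ * ‖x.snd‖ := by positivity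
      nlinarith
    simp only [WithLp.fstL_apply, WithLp.sndL_apply] at h1 h2
    calc ‖x‖ ^ k * ((l.choose i : ℝ) * ‖iteratedFDeriv ℝ i (fun x => f x.fst) x‖ *
          ‖iteratedFDeriv ℝ (l - i) (fun x => g x.snd) x‖)
        ≤ ((1 + ‖x.fst‖) * (1 + ‖x.snd‖)) ^ k * ((l.choose i : ℝ) *
          ‖iteratedFDeriv ℝ i f x.fst‖ * ‖iteratedFDeriv ℝ (l - i) g x.snd‖) := by gcongr
      _ = (l.choose i : ℝ) * ((1 + ‖x.fst‖) ^ k * ‖iteratedFDeriv ℝ i f x.fst‖) *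
          ((1 + ‖x.snd‖) ^ k * ‖iteratedFDeriv ℝ (l - i) g x.snd‖) := by rw [mul_pow]; ring
      _ ≤ (l.choose i : ℝ) * S f * S g := by gcongr

theorem SchwartzMap.tensor_apply (f g : 𝓢(V, ℂ)) (x : WithLp 2 (V × V)) :
    SchwartzMap.tensor f g x = f x.fst * g x.snd := rfl

/-- Restriction of a Schwartz function on `V × V` to the diagonal. -/
noncomputable def SchwartzMap.diagonal : 𝓢(WithLp 2 (V × V), ℂ) →L[ℂ] 𝓢(V, ℂ) :=
  SchwartzMap.compCLM ℂ (g := fun z : V => WithLp.toLp 2 (z, z))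
    ((WithLp.prodContinuousLinearEquiv 2 ℝ V V).symm.toContinuousLinearMap.comp
      ((ContinuousLinearMap.id ℝ V).prod (ContinuousLinearMap.id ℝ V))).hasTemperateGrowth
    ⟨1, 1, fun z => by
      have := WithLp.norm_fst_le V (WithLp.toLp 2 (z, z))
      simp only [one_mul, pow_one]
      exact this.trans (by simp)⟩

theorem SchwartzMap.diagonal_apply (F : 𝓢(WithLp 2 (V × V), ℂ)) (z : V) :
    SchwartzMap.diagonal F z = F (WithLp.toLp 2 (z, z)) := rfl

end

/-! ### The star product in Fourier variables -/

section

variable {V : Type*} [NormedAddCommGroup V] [InnerProductSpace ℝ V]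

/-- The remainder `(e^{is} - 1 - is) / s²`. -/
noncomputable def expTaylorRemainder : ℝ → ℂ := exists_hasTemperateGrowth_exp_taylor.choose

theorem hasTemperateGrowth_expTaylorRemainder : expTaylorRemainder.HasTemperateGrowth :=
  exists_hasTemperateGrowth_exp_taylor.choose_spec.1

theorem exp_I_mul_eq (s : ℝ) : Complex.exp (Complex.I * s) =
    1 + Complex.I * s + (s : ℂ) ^ 2 * expTaylorRemainder s :=
  exists_hasTemperateGrowth_exp_taylor.choose_spec.2 s

/-- The phase `(η, κ) ↦ 2π² κ · L η` of the star product in Fourier variables. -/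
noncomputable def starPhase (L : V →L[ℝ] V) (x : WithLp 2 (V × V)) : ℝ :=
  2 * Real.pi ^ 2 * inner ℝ x.snd (L x.fst)

/-- The second-order Taylor remainder, divided by `t²`, of the oscillating factor
`exp (i t κ · L η)`, jointly in the frequencies and in the parameters `(L, t)`. -/
noncomputable def starMultiplier (q : WithLp 2 (V × V) × ((V →L[ℝ] V) × ℝ)) : ℂ :=
  (starPhase q.2.1 q.1 : ℂ) ^ 2 * expTaylorRemainder (q.2.2 * starPhase q.2.1 q.1)

/-- The parameters `(L, t)` count as variables here: `(L, η) ↦ L η` is bilinear, so the phase is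
polynomially bounded jointly. -/
theorem hasTemperateGrowth_starMultiplier :
    (starMultiplier (V := V)).HasTemperateGrowth := by
  let Q := WithLp 2 (V × V) × ((V →L[ℝ] V) × ℝ)
  have hx : (fun q : Q => q.1).HasTemperateGrowth :=
    (ContinuousLinearMap.fst ℝ (WithLp 2 (V × V)) ((V →L[ℝ] V) × ℝ)).hasTemperateGrowth
  have hp : (fun q : Q => q.2).HasTemperateGrowth :=
    (ContinuousLinearMap.snd ℝ (WithLp 2 (V × V)) ((V →L[ℝ] V) × ℝ)).hasTemperateGrowth
  have h1 : (fun q : Q => q.1.fst).HasTemperateGrowth :=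
    (WithLp.fstL 2 ℝ V V).hasTemperateGrowth.comp hx
  have h2 : (fun q : Q => q.1.snd).HasTemperateGrowth :=
    (WithLp.sndL 2 ℝ V V).hasTemperateGrowth.comp hx
  have hL : (fun q : Q => q.2.1).HasTemperateGrowth :=
    (ContinuousLinearMap.fst ℝ (V →L[ℝ] V) ℝ).hasTemperateGrowth.comp hp
  have ht : (fun q : Q => q.2.2).HasTemperateGrowth :=
    (ContinuousLinearMap.snd ℝ (V →L[ℝ] V) ℝ).hasTemperateGrowth.comp hp
  have h3 : (fun q : Q => q.2.1 q.1.fst).HasTemperateGrowth :=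
    (ContinuousLinearMap.id ℝ (V →L[ℝ] V)).bilinear_hasTemperateGrowth hL h1
  have h4 : (fun q : Q => starPhase q.2.1 q.1).HasTemperateGrowth :=
    (Function.HasTemperateGrowth.const (2 * Real.pi ^ 2)).fun_mul
      ((innerSL ℝ).bilinear_hasTemperateGrowth h2 h3)
  have h5 : (fun q : Q => (starPhase q.2.1 q.1 : ℂ)).HasTemperateGrowth :=
    Function.Complex.hasTemperateGrowth_ofReal.comp h4
  have h6 : (fun q : Q => expTaylorRemainder (q.2.2 * starPhase q.2.1 q.1)).HasTemperateGrowth :=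
    hasTemperateGrowth_expTaylorRemainder.comp (ht.fun_mul h4)
  exact (h5.fun_pow 2).fun_mul h6

theorem hasTemperateGrowth_starMultiplier_slice (p : (V →L[ℝ] V) × ℝ) :
    (fun x : WithLp 2 (V × V) => starMultiplier (x, p)).HasTemperateGrowth := by
  refine hasTemperateGrowth_starMultiplier.comp
    (f := fun x : WithLp 2 (V × V) => (x, p)) ?_
  have h : (fun x : WithLp 2 (V × V) => (x, p)) =
      fun x => ContinuousLinearMap.inl ℝ (WithLp 2 (V × V)) ((V →L[ℝ] V) × ℝ) x + (0, p) := by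
    ext x <;> simp
  rw [h]
  fun_prop

variable [FiniteDimensional ℝ V] [MeasurableSpace V] [BorelSpace V]

theorem SchwartzMap.diagonal_fourierInv_apply (H : 𝓢(WithLp 2 (V × V), ℂ)) (z : V) :
    SchwartzMap.diagonal (𝓕⁻ H) z = ∫ η : V, ∫ κ : V,
      Complex.exp (2 * Real.pi * Complex.I * (inner ℝ η z + inner ℝ κ z : ℝ)) *
        H (WithLp.toLp 2 (η, κ)) := by
  rw [SchwartzMap.diagonal_apply, SchwartzMap.fourierInv_coe, Real.fourierInv_eq',
    ← (WithLp.volume_preserving_toLp V V).integral_comp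
      (MeasurableEquiv.toLp 2 (V × V)).measurableEmbedding,
    MeasureTheory.Measure.volume_eq_prod, MeasureTheory.integral_prod]
  · refine MeasureTheory.integral_congr_ae (Filter.Eventually.of_forall fun η => ?_)
    refine MeasureTheory.integral_congr_ae (Filter.Eventually.of_forall fun κ => ?_)
    simp only [WithLp.prod_inner_apply, smul_eq_mul]
    congr 2
    push_cast
    ring
  · have hH : MeasureTheory.Integrable (fun q : V × V => H (WithLp.toLp 2 q)) :=
      (WithLp.volume_preserving_toLp V V).integrable_comp_of_integrable H.integrable
    refine (hH.norm.mono' (Continuous.aestronglyMeasurable ?_) ?_)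
    · have hc : Continuous fun q : V × V => WithLp.toLp 2 q :=
        (WithLp.prodContinuousLinearEquiv 2 ℝ V V).symm.continuous
      fun_prop
    · refine Filter.Eventually.of_forall fun q => ?_
      rw [norm_smul, Complex.norm_exp_ofReal_mul_I, one_mul]

theorem SchwartzMap.apply_eq_integral_fourier (c : 𝓢(V, ℂ)) (z : V) :
    c z = ∫ η : V, Complex.exp (2 * Real.pi * Complex.I * (inner ℝ η z : ℝ)) * 𝓕 c η := by
  have h : 𝓕⁻ (𝓕 c) = c := FourierTransform.fourierInv_fourier_eq c
  conv_lhs => rw [← h, SchwartzMap.fourierInv_coe, Real.fourierInv_eq']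
  refine MeasureTheory.integral_congr_ae (Filter.Eventually.of_forall fun η => ?_)
  simp only [smul_eq_mul]
  congr 2
  push_cast
  ring

/-- The double integral factors into two Fourier inversions; this turns the Taylor terms back into
products of derivatives. -/
theorem SchwartzMap.diagonal_fourierInv_tensor (c d : 𝓢(V, ℂ)) (z : V) :
    SchwartzMap.diagonal (𝓕⁻ (SchwartzMap.tensor (V := V) (𝓕 c) (𝓕 d))) z = c z * d z := by
  rw [SchwartzMap.diagonal_fourierInv_apply, c.apply_eq_integral_fourier z,
    d.apply_eq_integral_fourier z, ← MeasureTheory.integral_mul_const]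
  refine MeasureTheory.integral_congr_ae (Filter.Eventually.of_forall fun η => ?_)
  beta_reduce
  rw [← MeasureTheory.integral_const_mul]
  refine MeasureTheory.integral_congr_ae (Filter.Eventually.of_forall fun κ => ?_)
  simp only [SchwartzMap.tensor_apply, WithLp.toLp_fst, WithLp.toLp_snd]
  push_cast
  rw [mul_add, Complex.exp_add]
  ring

/-- The second-order remainder of the star product, divided by `t²`. -/
noncomputable def starRemainder (a b : 𝓢(V, ℂ)) (p : (V →L[ℝ] V) × ℝ) : 𝓢(V, ℂ) :=
  SchwartzMap.diagonal (𝓕⁻ (SchwartzMap.smulLeftCLM ℂ (fun x => starMultiplier (x, p))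
    (SchwartzMap.tensor (𝓕 a) (𝓕 b))))

open LineDeriv in
theorem integral_exp_starPhase {ι : Type*} [Fintype ι] (e : OrthonormalBasis ι ℝ V)
    (a b : 𝓢(V, ℂ)) (L : V →L[ℝ] V) (t : ℝ) (z : V) :
    (∫ η : V, ∫ κ : V,
      Complex.exp (2 * Real.pi * Complex.I * (inner ℝ η z + inner ℝ κ z : ℝ)) *
        (Complex.exp (Complex.I * (t * starPhase L (WithLp.toLp 2 (η, κ)) : ℝ)) *
          (𝓕 a η * 𝓕 b κ))) =
      a z * b z - Complex.I * t / 2 * ∑ k, ∂_{e k} a z * ∂_{L (e k)} b z +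
        (t : ℂ) ^ 2 * starRemainder a b (L, t) z := by
  -- Taylor expansion of the integrand. The two derivatives produce `(2πi)² κ·Lη = -4π² κ·Lη`, so
  -- the coefficient `-it/2` restores `it · 2π² κ·Lη`.
  let H : 𝓢(WithLp 2 (V × V), ℂ) := SchwartzMap.tensor (𝓕 a) (𝓕 b) +
    (-(Complex.I * t / 2)) • (∑ k, SchwartzMap.tensor (𝓕 (∂_{e k} a)) (𝓕 (∂_{L (e k)} b))) +
    ((t : ℂ) ^ 2) • SchwartzMap.smulLeftCLM ℂ (fun x => starMultiplier (x, (L, t)))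
      (SchwartzMap.tensor (𝓕 a) (𝓕 b))
  have hH (x : WithLp 2 (V × V)) : H x = Complex.exp (Complex.I * (t * starPhase L x : ℝ)) *
      (𝓕 a x.fst * 𝓕 b x.snd) := by
    have hinner (v : V) : (inner ℝ · v : V → ℝ).HasTemperateGrowth := by fun_prop
    have hL : inner ℝ x.snd (L x.fst) = ∑ k, inner ℝ x.fst (e k) * inner ℝ x.snd (L (e k)) := by
      conv_lhs => rw [← e.sum_repr' x.fst, map_sum, inner_sum]
      refine Finset.sum_congr rfl fun k _ => ?_
      rw [map_smul, inner_smul_right, real_inner_comm]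
    have hsum : ∑ k, 𝓕 (∂_{e k} a) x.fst * 𝓕 (∂_{L (e k)} b) x.snd =
        (2 * Real.pi * Complex.I) ^ 2 * (inner ℝ x.snd (L x.fst) : ℝ) *
          (𝓕 a x.fst * 𝓕 b x.snd) := by
      rw [hL, Complex.ofReal_sum, Finset.mul_sum, Finset.sum_mul]
      refine Finset.sum_congr rfl fun k _ => ?_
      simp only [SchwartzMap.fourier_lineDerivOp_eq, smul_apply,
        SchwartzMap.smulLeftCLM_apply_apply (hinner _), smul_eq_mul, Complex.real_smul]
      push_cast
      ring
    simp only [H, add_apply, smul_apply, sum_apply, SchwartzMap.tensor_apply, hsum,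
      SchwartzMap.smulLeftCLM_apply_apply (hasTemperateGrowth_starMultiplier_slice (L, t)),
      exp_I_mul_eq, smul_eq_mul]
    simp only [starMultiplier, starPhase]
    push_cast
    linear_combination (-2 * Real.pi ^ 2 * Complex.I * t * (inner ℝ x.snd (L x.fst) : ℝ) *
      (𝓕 a x.fst * 𝓕 b x.snd)) * Complex.I_sq
  have h := SchwartzMap.diagonal_fourierInv_apply H z
  simp only [hH] at h
  refine h.symm.trans ?_
  simp only [H, FourierTransform.fourierInv_add, FourierTransform.fourierInv_smul,
    FourierTransform.fourierInv_sum, map_add, map_smul, map_sum, add_apply, smul_apply, sum_apply,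
    SchwartzMap.diagonal_fourierInv_tensor, smul_eq_mul, starRemainder]
  ring

theorem schwartzIsBigO_starRemainder {α : Type*} {l : Filter α} (a b : 𝓢(V, ℂ))
    {p : α → (V →L[ℝ] V) × ℝ} {r : ℝ} (hp : ∀ᶠ t in l, ‖p t‖ ≤ r) :
    SchwartzIsBigO (fun t => starRemainder a b (p t)) l (fun _ => 1) := by
  have h : SchwartzIsBigO (fun t => SchwartzMap.smulLeftCLM ℂ (fun x => starMultiplier (x, p t))
      (SchwartzMap.tensor (𝓕 a) (𝓕 b))) l (fun _ => 1) := by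
    refine SchwartzIsBigO.of_bounded fun i j => ?_
    obtain ⟨C, hC⟩ := SchwartzMap.exists_seminorm_smulLeftCLM_slice_le
      (hasTemperateGrowth_starMultiplier (V := V)) (SchwartzMap.tensor (𝓕 a) (𝓕 b)) r i j
    exact ⟨C, hp.mono fun t ht => hC _ ht⟩
  exact (h.map (FourierTransform.fourierInvCLM ℂ 𝓢(WithLp 2 (V × V), ℂ))).map
    SchwartzMap.diagonal

end

/-! ### Affine changes of variables -/

section

open MeasureTheory

variable {V : Type*} [NormedAddCommGroup V] [InnerProductSpace ℝ V] [FiniteDimensional ℝ V]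
  [MeasurableSpace V] [BorelSpace V]
  {F : Type*} [NormedAddCommGroup F]

theorem map_add_linearMap_volume {T : V →ₗ[ℝ] V} (hT : LinearMap.det T ≠ 0) (c : V) :
    Measure.map (fun x => c + T x) volume = ENNReal.ofReal |(LinearMap.det T)⁻¹| • volume := by
  have h := Measure.map_map (μ := (volume : Measure V)) (measurable_const_add c)
    T.continuous_of_finiteDimensional.measurable
  rw [Measure.map_linearMap_addHaar_eq_smul_addHaar volume hT, Measure.map_smul,
    map_add_left_eq_self] at h
  exact h.symm

theorem measurableEmbedding_add_linearMap {T : V →ₗ[ℝ] V} (hT : LinearMap.det T ≠ 0) (c : V) :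
    MeasurableEmbedding (fun x => c + T x) :=
  (measurableEmbedding_addLeft c).comp
    (LinearEquiv.ofIsUnitDet (f := T) (v := Module.finBasis ℝ V) (v' := Module.finBasis ℝ V)
      (by simpa using hT)).toContinuousLinearEquiv.toHomeomorph.measurableEmbedding

theorem integral_comp_add_linearMap [NormedSpace ℝ F] {T : V →ₗ[ℝ] V}
    (hT : LinearMap.det T ≠ 0) (c : V) (f : V → F) :
    ∫ x, f (c + T x) = |LinearMap.det T|⁻¹ • ∫ x, f x := by
  rw [← (measurableEmbedding_add_linearMap hT c).integral_map (μ := volume) f,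
    map_add_linearMap_volume hT, integral_smul_measure, ENNReal.toReal_ofReal (abs_nonneg _),
    abs_inv]

theorem MeasureTheory.Integrable.comp_add_linearMap {T : V →ₗ[ℝ] V}
    (hT : LinearMap.det T ≠ 0) (c : V) {f : V → F} (hf : Integrable f) :
    Integrable fun x => f (c + T x) := by
  rw [← Function.comp_def f, ← (measurableEmbedding_add_linearMap hT c).integrable_map_iff,
    map_add_linearMap_volume hT]
  exact hf.smul_measure ENNReal.ofReal_ne_top

end

/-! ### The Weyl integral for an antisymmetric invertible map -/

section

open MeasureTheory

variable {ι : Type*} [Fintype ι] {L : EuclideanSpace ℝ ι →L[ℝ] EuclideanSpace ℝ ι}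

/-- The oscillating factor has modulus one, and invertibility of `L` makes the `ζ`-integral of the
modulus of the `a` factor finite and independent of `u`. -/
theorem integrable_weylIntegrand_affine (hL : LinearMap.det L.toLinearMap ≠ 0) (ħ : ℝ)
    (a b : 𝓢(EuclideanSpace ℝ ι, ℂ)) (z : EuclideanSpace ℝ ι) :
    Integrable (weylIntegrand ħ (fun y ζ => a (y - (1 / 2 : ℝ) • L ζ)) b z) := by
  have hT : LinearMap.det (-(1 / 2 : ℝ) • L.toLinearMap) ≠ 0 := by
    rw [LinearMap.det_smul]
    exact mul_ne_zero (pow_ne_zero _ (by norm_num)) hL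
  have hnorm (q : EuclideanSpace ℝ ι × EuclideanSpace ℝ ι) :
      ‖weylIntegrand ħ (fun y ζ => a (y - (1 / 2 : ℝ) • L ζ)) b z q‖ =
        ‖a ((1 / 2 : ℝ) • (z + q.1) + (-(1 / 2 : ℝ) • L.toLinearMap) q.2)‖ * ‖b q.1‖ := by
    rw [weylIntegrand, norm_mul, norm_mul, mul_comm Complex.I, Complex.norm_exp_ofReal_mul_I,
      one_mul]
    simp [sub_eq_add_neg]
  have hcont : Continuous (weylIntegrand ħ (fun y ζ => a (y - (1 / 2 : ℝ) • L ζ)) b z) := by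
    unfold weylIntegrand
    fun_prop
  rw [Measure.volume_eq_prod, integrable_prod_iff hcont.aestronglyMeasurable]
  refine ⟨Filter.Eventually.of_forall fun u => ?_, ?_⟩
  · rw [← integrable_norm_iff (by fun_prop)]
    simp only [hnorm]
    exact (a.integrable.comp_add_linearMap hT _).norm.mul_const _
  · simp only [hnorm, integral_mul_const]
    simp only [integral_comp_add_linearMap hT _ fun y => ‖a y‖]
    exact b.integrable.norm.const_mul _

/-- Substitute `u = z + πħ Lη` and `w = (z + u)/2 - Lζ/2`. Antisymmetry turns the phase into `2π (z
- w)·η`, so integrating over `w` gives `𝓕 a η`. -/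
theorem weylOperator_affine_eq (hL : LinearMap.det L.toLinearMap ≠ 0)
    (hskew : ∀ x y, inner ℝ (L x) y = -inner ℝ x (L y)) {ħ : ℝ} (hħ : 0 < ħ)
    (a b : 𝓢(EuclideanSpace ℝ ι, ℂ)) (z : EuclideanSpace ℝ ι) :
    weylOperator ħ (fun y ζ => a (y - (1 / 2 : ℝ) • L ζ)) b z =
      ∫ η, Complex.exp (2 * Real.pi * Complex.I * (inner ℝ η z : ℝ)) * 𝓕 a η *
        b (z + (Real.pi * ħ) • L η) := by
  have hT : LinearMap.det (-(1 / 2 : ℝ) • L.toLinearMap) ≠ 0 := by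
    rw [LinearMap.det_smul]
    exact mul_ne_zero (pow_ne_zero _ (by norm_num)) hL
  have hS : LinearMap.det ((Real.pi * ħ) • L.toLinearMap) ≠ 0 := by
    rw [LinearMap.det_smul]
    exact mul_ne_zero (pow_ne_zero _ (by positivity)) hL
  have hzero (x : EuclideanSpace ℝ ι) : inner ℝ (L x) x = 0 := by
    have := hskew x x
    rw [real_inner_comm (L x) x] at this
    linarith
  let I := weylIntegrand ħ (fun y ζ => a (y - (1 / 2 : ℝ) • L ζ)) b z
  have hinner (η : EuclideanSpace ℝ ι) :
      ∫ ζ, I (z + ((Real.pi * ħ) • L.toLinearMap) η, ζ) =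
        |LinearMap.det (-(1 / 2 : ℝ) • L.toLinearMap)|⁻¹ •
          (Complex.exp (2 * Real.pi * Complex.I * (inner ℝ η z : ℝ)) * 𝓕 a η *
            b (z + (Real.pi * ħ) • L η)) := by
    have h1 (ζ : EuclideanSpace ℝ ι) : I (z + ((Real.pi * ħ) • L.toLinearMap) η, ζ) =
        (fun w => Complex.exp (2 * Real.pi * Complex.I * (inner ℝ (z - w) η : ℝ)) * a w *
          b (z + (Real.pi * ħ) • L η))
          (z + (Real.pi * ħ / 2) • L η + (-(1 / 2 : ℝ) • L.toLinearMap) ζ) := by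
      have harg : (1 / 2 : ℝ) • (z + (z + (Real.pi * ħ) • L η)) - (1 / 2 : ℝ) • L ζ =
          z + (Real.pi * ħ / 2) • L η + -(1 / 2 : ℝ) • L ζ := by module
      simp only [I, weylIntegrand, LinearMap.smul_apply, ContinuousLinearMap.coe_coe, harg]
      congr 3
      have hphase : inner ℝ ζ (z - (z + (Real.pi * ħ) • L η)) / ħ =
          2 * Real.pi * inner ℝ (z - (z + (Real.pi * ħ / 2) • L η + -(1 / 2 : ℝ) • L ζ)) η := by
        have h2 : z - (z + (Real.pi * ħ / 2) • L η + -(1 / 2 : ℝ) • L ζ) =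
            (1 / 2 : ℝ) • L ζ - (Real.pi * ħ / 2) • L η := by module
        have h3 : z - (z + (Real.pi * ħ) • L η) = -((Real.pi * ħ) • L η) := by abel
        rw [h2, h3, inner_neg_right, inner_smul_right, inner_sub_left, real_inner_smul_left,
          real_inner_smul_left, hzero, hskew]
        field_simp
        ring
      rw [hphase]
      push_cast
      ring
    simp only [h1]
    rw [integral_comp_add_linearMap hT _ fun w =>
      Complex.exp (2 * Real.pi * Complex.I * (inner ℝ (z - w) η : ℝ)) * a w *
          b (z + (Real.pi * ħ) • L η), integral_mul_const]
    congr 2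
    rw [SchwartzMap.fourier_coe, Real.fourier_eq', ← integral_const_mul]
    refine integral_congr_ae (Filter.Eventually.of_forall fun w => ?_)
    simp only [smul_eq_mul, inner_sub_left]
    rw [← mul_assoc, ← Complex.exp_add]
    congr 2
    rw [real_inner_comm]
    push_cast
    ring
  have hu := integral_comp_add_linearMap hS z fun u => ∫ ζ, I (u, ζ)
  simp only [hinner] at hu
  rw [integral_smul] at hu
  have hint := integrable_weylIntegrand_affine hL ħ a b z
  rw [weylOperator]
  rw [Measure.volume_eq_prod] at hint ⊢
  rw [integral_prod _ hint]
  have hu' : ∫ u, ∫ ζ, I (u, ζ) = ((2 * Real.pi * ħ) ^ Fintype.card ι : ℝ) •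
      ∫ η, Complex.exp (2 * Real.pi * Complex.I * (inner ℝ η z : ℝ)) * 𝓕 a η *
        b (z + (Real.pi * ħ) • L η) := by
    -- The determinants of `L` cancel between the two Jacobians; what remains offsets the Weyl
    -- prefactor.
    have hdet : |LinearMap.det ((Real.pi * ħ) • L.toLinearMap)| *
        |LinearMap.det (-(1 / 2 : ℝ) • L.toLinearMap)|⁻¹ =
          (2 * Real.pi * ħ) ^ Fintype.card ι := by
      rw [LinearMap.det_smul, LinearMap.det_smul, finrank_euclideanSpace, abs_mul, abs_mul,
        abs_pow, abs_pow, abs_neg, abs_of_pos (by positivity : (0 : ℝ) < Real.pi * ħ),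
        abs_of_pos (by norm_num : (0 : ℝ) < 1 / 2), mul_assoc 2, mul_pow 2, mul_inv, one_div,
        inv_pow, inv_inv]
      have := abs_pos.mpr hL
      field_simp
    rw [← hdet, mul_smul, hu, smul_smul, mul_inv_cancel₀ (abs_pos.mpr hS).ne', one_smul]
  rw [hu', ← Complex.real_smul, smul_smul, ← mul_pow, one_div_mul_cancel (by positivity),
    one_pow, one_smul]

theorem weylOperator_affine_eq_taylor [DecidableEq ι] (hL : LinearMap.det L.toLinearMap ≠ 0)
    (hskew : ∀ x y, inner ℝ (L x) y = -inner ℝ x (L y)) {ħ : ℝ} (hħ : 0 < ħ)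
    (a b : 𝓢(EuclideanSpace ℝ ι, ℂ)) (z : EuclideanSpace ℝ ι) :
    weylOperator ħ (fun y ζ => a (y - (1 / 2 : ℝ) • L ζ)) b z =
      a z * b z - Complex.I * ħ / 2 *
        ∑ k, fderiv ℝ a z (EuclideanSpace.single k 1) *
          fderiv ℝ b z (L (EuclideanSpace.single k 1)) +
        (ħ : ℂ) ^ 2 * starRemainder a b (L, ħ) z := by
  have h := integral_exp_starPhase (EuclideanSpace.basisFun ι ℝ) a b L ħ z
  simp only [EuclideanSpace.basisFun_apply, SchwartzMap.lineDerivOp_apply_eq_fderiv] at h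
  rw [weylOperator_affine_eq hL hskew hħ, ← h]
  refine integral_congr_ae (Filter.Eventually.of_forall fun η => ?_)
  beta_reduce
  -- Fourier inversion turns the shift of `b` by `πħ Lη` into the factor `exp(iħ · 2π² κ·Lη)`.
  rw [b.apply_eq_integral_fourier (z + (Real.pi * ħ) • L η), ← integral_const_mul]
  refine integral_congr_ae (Filter.Eventually.of_forall fun κ => ?_)
  simp only [starPhase, WithLp.toLp_fst, WithLp.toLp_snd, inner_add_right, inner_smul_right]
  have h1 : Complex.exp (2 * Real.pi * Complex.I *
      ((inner ℝ κ z + Real.pi * ħ * inner ℝ κ (L η) : ℝ) : ℂ)) =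
      Complex.exp (2 * Real.pi * Complex.I * (inner ℝ κ z : ℝ)) *
        Complex.exp (Complex.I * (ħ * (2 * Real.pi ^ 2 * inner ℝ κ (L η)) : ℝ)) := by
    rw [← Complex.exp_add]
    congr 1
    push_cast
    ring
  rw [h1, Complex.ofReal_add, mul_add, Complex.exp_add]
  ring

end

/-! ### The matrix `Ω` and the star commutator -/

section

variable {n : ℕ}

theorem transpose_omegaMatrix {ħ : ℝ} {Θ N : Matrix (Fin n) (Fin n) ℝ}
    (hΘ : Θ.transpose = -Θ) (hN : N.transpose = -N) :
    (omegaMatrix ħ Θ N).transpose = -omegaMatrix ħ Θ N := by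
  simp [omegaMatrix, Matrix.fromBlocks_transpose, Matrix.fromBlocks_neg, hΘ, hN]

theorem tendsto_omegaMatrix {Θ N : ℝ → Matrix (Fin n) (Fin n) ℝ}
    (hΘ : ∀ α β, (fun ħ : ℝ => Θ ħ α β) =o[𝓝[>] 0] (fun ħ : ℝ => ħ ^ 2))
    (hN : ∀ α β, (fun ħ : ℝ => N ħ α β) =o[𝓝[>] 0] (fun ħ : ℝ => ħ ^ 2)) :
    Filter.Tendsto (fun ħ => omegaMatrix ħ (Θ ħ) (N ħ)) (𝓝[>] 0)
      (𝓝 (Matrix.fromBlocks 0 1 (-1) 0)) := by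
  have key {f : ℝ → ℝ} (hf : f =o[𝓝[>] 0] (fun ħ : ℝ => ħ ^ 2)) :
      Filter.Tendsto (fun ħ => ħ⁻¹ * f ħ) (𝓝[>] 0) (𝓝 0) := by
    -- `ħ⁻¹ f = (f / ħ²) · ħ`.
    have h := hf.tendsto_div_nhds_zero.mul
      (tendsto_nhdsWithin_of_tendsto_nhds (Filter.tendsto_id (α := ℝ) (x := 𝓝 0)) (s := Set.Ioi 0))
    rw [zero_mul] at h
    refine h.congr' ?_
    filter_upwards [self_mem_nhdsWithin] with ħ hħ
    have : ħ ≠ 0 := (Set.mem_Ioi.mp hħ).ne'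
    simp only [id]
    field_simp
  refine tendsto_pi_nhds.mpr fun i => tendsto_pi_nhds.mpr fun j => ?_
  rcases i with i | i <;> rcases j with j | j <;>
    simp only [omegaMatrix, Matrix.fromBlocks_apply₁₁, Matrix.fromBlocks_apply₁₂,
      Matrix.fromBlocks_apply₂₁, Matrix.fromBlocks_apply₂₂, Matrix.smul_apply, smul_eq_mul,
      Matrix.zero_apply]
  · exact key (hΘ i j)
  · exact tendsto_const_nhds
  · exact tendsto_const_nhds
  · exact key (hN i j)

theorem det_fromBlocks_standard_ne_zero :
    (Matrix.fromBlocks 0 1 (-1) 0 : Matrix (Fin n ⊕ Fin n) (Fin n ⊕ Fin n) ℝ).det ≠ 0 := by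
  have h : (Matrix.fromBlocks 0 1 (-1) 0 : Matrix (Fin n ⊕ Fin n) (Fin n ⊕ Fin n) ℝ) *
      Matrix.fromBlocks 0 (-1) 1 0 = 1 := by
    simp [Matrix.fromBlocks_multiply]
  exact (Matrix.isUnit_det_of_right_inverse h).ne_zero

/-- The continuous linear map on phase space given by a matrix. -/
noncomputable abbrev phaseSpaceMap (Ω : Matrix (Fin n ⊕ Fin n) (Fin n ⊕ Fin n) ℝ) :
    PhaseSpace n →L[ℝ] PhaseSpace n :=
  (Matrix.toEuclideanLin Ω).toContinuousLinearMap

theorem det_phaseSpaceMap (Ω : Matrix (Fin n ⊕ Fin n) (Fin n ⊕ Fin n) ℝ) :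
    LinearMap.det (phaseSpaceMap Ω).toLinearMap = Ω.det := by
  simp [phaseSpaceMap, Matrix.toLpLin_eq_toLin]

theorem inner_phaseSpaceMap {Ω : Matrix (Fin n ⊕ Fin n) (Fin n ⊕ Fin n) ℝ}
    (hΩ : Ω.transpose = -Ω) (x y : PhaseSpace n) :
    inner ℝ (phaseSpaceMap Ω x) y = -inner ℝ x (phaseSpaceMap Ω y) := by
  have h := LinearMap.adjoint_inner_right (Matrix.toEuclideanLin Ω) x y
  rw [← Matrix.toEuclideanLin_conjTranspose_eq_adjoint] at h
  simp only [Matrix.conjTranspose_eq_transpose_of_trivial, hΩ, map_neg, LinearMap.neg_apply,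
    inner_neg_right] at h
  exact h.symm

theorem continuous_phaseSpaceMap : Continuous (phaseSpaceMap (n := n)) :=
  (LinearMap.toContinuousLinearMap.toLinearMap ∘ₗ
    (Matrix.toEuclideanLin (𝕜 := ℝ) (m := Fin n ⊕ Fin n)
      (n := Fin n ⊕ Fin n)).toLinearMap).continuous_of_finiteDimensional

theorem phaseSpaceMap_single (Ω : Matrix (Fin n ⊕ Fin n) (Fin n ⊕ Fin n) ℝ)
    (k : Fin n ⊕ Fin n) : phaseSpaceMap Ω (EuclideanSpace.single k 1) =
      ∑ j, Ω j k • EuclideanSpace.single j (1 : ℝ) := by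
  ext i
  simp [Matrix.toLpLin_apply, Pi.single_apply, -Fintype.sum_sum_type]

theorem omegaStar_sub_omegaStar {Ω : Matrix (Fin n ⊕ Fin n) (Fin n ⊕ Fin n) ℝ}
    (hdet : Ω.det ≠ 0) (hΩ : Ω.transpose = -Ω) {ħ : ℝ} (hħ : 0 < ħ)
    (a b : 𝓢(PhaseSpace n, ℂ)) (z : PhaseSpace n) :
    omegaStar ħ Ω a b z - omegaStar ħ Ω b a z =
      -(Complex.I * ħ) * (∑ k, ∑ j, (Ω j k : ℂ) *
        (fderiv ℝ a z (EuclideanSpace.single k 1) * fderiv ℝ b z (EuclideanSpace.single j 1))) +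
      (ħ : ℂ) ^ 2 * (starRemainder a b (phaseSpaceMap Ω, ħ) z -
        starRemainder b a (phaseSpaceMap Ω, ħ) z) := by
  have hL : LinearMap.det (phaseSpaceMap Ω).toLinearMap ≠ 0 := by rwa [det_phaseSpaceMap]
  have h1 := weylOperator_affine_eq_taylor hL (inner_phaseSpaceMap hΩ) hħ a b z
  have h2 := weylOperator_affine_eq_taylor hL (inner_phaseSpaceMap hΩ) hħ b a z
  simp only [phaseSpaceMap_single, map_sum, map_smul, Complex.real_smul, Finset.mul_sum] at h1 h2
  have hskew (j k) : Ω k j = -Ω j k := by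
    rw [← Matrix.transpose_apply Ω, hΩ, Matrix.neg_apply]
  -- Exchanging `j` and `k` and using antisymmetry, the first-order term changes sign when `a` and
  -- `b` are swapped, so the commutator doubles it.
  have h3 : ∑ k, ∑ j, Complex.I * (ħ : ℂ) / 2 * (fderiv ℝ b z (EuclideanSpace.single k 1) *
        ((Ω j k : ℂ) * fderiv ℝ a z (EuclideanSpace.single j 1))) =
      -∑ k, ∑ j, Complex.I * (ħ : ℂ) / 2 * (fderiv ℝ a z (EuclideanSpace.single k 1) *
        ((Ω j k : ℂ) * fderiv ℝ b z (EuclideanSpace.single j 1))) := by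
    rw [Finset.sum_comm]
    simp only [← Finset.sum_neg_distrib]
    refine Finset.sum_congr rfl fun k _ => Finset.sum_congr rfl fun j _ => ?_
    rw [hskew j k]
    push_cast
    ring
  rw [h3] at h2
  change weylOperator ħ (fun y ζ => a (y - (1 / 2 : ℝ) • phaseSpaceMap Ω ζ)) b z -
    weylOperator ħ (fun y ζ => b (y - (1 / 2 : ℝ) • phaseSpaceMap Ω ζ)) a z = _
  have h4 : (∑ k, ∑ j, (Ω j k : ℂ) *
        (fderiv ℝ a z (EuclideanSpace.single k 1) * fderiv ℝ b z (EuclideanSpace.single j 1))) *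
        (Complex.I * ħ) = 2 * ∑ k, ∑ j, Complex.I * (ħ : ℂ) / 2 *
          (fderiv ℝ a z (EuclideanSpace.single k 1) *
        ((Ω j k : ℂ) * fderiv ℝ b z (EuclideanSpace.single j 1))) := by
    simp only [Finset.mul_sum, Finset.sum_mul]
    refine Finset.sum_congr rfl fun k _ => Finset.sum_congr rfl fun j _ => ?_
    ring
  rw [h1, h2]
  linear_combination h4

/-- The row index of `Ω` goes with `b`, so the lower-left block `-I` multiplies `∂ₓa ∂ₚb`: hence the
minus sign before the bracket. -/
theorem sum_omegaMatrix_mul (ħ : ℝ) (Θ N : Matrix (Fin n) (Fin n) ℝ)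
    (a b : PhaseSpace n → ℂ) (z : PhaseSpace n) :
    ∑ k, ∑ j, (omegaMatrix ħ Θ N j k : ℂ) *
        (fderiv ℝ a z (EuclideanSpace.single k 1) * fderiv ℝ b z (EuclideanSpace.single j 1)) =
      -poissonBracket a b z + (ħ : ℂ)⁻¹ * ∑ k, ∑ j,
        ((Θ j k : ℂ) * (fderiv ℝ a z (EuclideanSpace.single (Sum.inl k) 1) *
            fderiv ℝ b z (EuclideanSpace.single (Sum.inl j) 1)) +
          (N j k : ℂ) * (fderiv ℝ a z (EuclideanSpace.single (Sum.inr k) 1) *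
            fderiv ℝ b z (EuclideanSpace.single (Sum.inr j) 1))) := by
  simp only [Fintype.sum_sum_type, omegaMatrix, Matrix.fromBlocks_apply₁₁,
    Matrix.fromBlocks_apply₁₂, Matrix.fromBlocks_apply₂₁, Matrix.fromBlocks_apply₂₂,
    Matrix.smul_apply, Matrix.neg_apply, Matrix.one_apply, smul_eq_mul, poissonBracket,
    Finset.sum_add_distrib, mul_add, Finset.mul_sum, Finset.sum_sub_distrib]
  simp only [apply_ite ((↑) : ℝ → ℂ), Complex.ofReal_neg, Complex.ofReal_mul, Complex.ofReal_inv,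
    Complex.ofReal_one, Complex.ofReal_zero, neg_mul, ite_mul, one_mul, zero_mul,
    Finset.sum_neg_distrib, Finset.sum_ite_eq', Finset.mem_univ, if_true, mul_assoc]
  ring

open LineDeriv in
/-- The Schwartz function `∂_v a · ∂_w b`. -/
noncomputable def derivProduct (a b : 𝓢(PhaseSpace n, ℂ)) (v w : PhaseSpace n) :
    𝓢(PhaseSpace n, ℂ) :=
  SchwartzMap.diagonal (SchwartzMap.tensor (∂_{v} a) (∂_{w} b))

theorem derivProduct_apply (a b : 𝓢(PhaseSpace n, ℂ)) (v w z : PhaseSpace n) :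
    derivProduct a b v w z = fderiv ℝ a z v * fderiv ℝ b z w := by
  simp [derivProduct, SchwartzMap.diagonal_apply, SchwartzMap.tensor_apply,
    SchwartzMap.lineDerivOp_apply_eq_fderiv]

/-- The contribution of the diagonal blocks of `Ω` to the star commutator. -/
noncomputable def blockRemainder (Θ N : Matrix (Fin n) (Fin n) ℝ) (a b : 𝓢(PhaseSpace n, ℂ)) :
    𝓢(PhaseSpace n, ℂ) :=
  ∑ k, ∑ j, ((-Complex.I * Θ j k) • derivProduct a b (EuclideanSpace.single (Sum.inl k) 1)
      (EuclideanSpace.single (Sum.inl j) 1) +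
    (-Complex.I * N j k) • derivProduct a b (EuclideanSpace.single (Sum.inr k) 1)
      (EuclideanSpace.single (Sum.inr j) 1))

theorem schwartzIsBigO_blockRemainder {Θ N : ℝ → Matrix (Fin n) (Fin n) ℝ}
    (hΘ : ∀ α β, (fun ħ : ℝ => Θ ħ α β) =o[𝓝[>] 0] (fun ħ : ℝ => ħ ^ 2))
    (hN : ∀ α β, (fun ħ : ℝ => N ħ α β) =o[𝓝[>] 0] (fun ħ : ℝ => ħ ^ 2))
    (a b : 𝓢(PhaseSpace n, ℂ)) :
    SchwartzIsBigO (fun ħ => blockRemainder (Θ ħ) (N ħ) a b) (𝓝[>] 0) (fun ħ : ℝ => ħ ^ 2) := by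
  have key {f : ℝ → ℝ} (hf : f =o[𝓝[>] 0] (fun ħ : ℝ => ħ ^ 2)) (P : 𝓢(PhaseSpace n, ℂ)) :
      SchwartzIsBigO (fun ħ => (-Complex.I * (f ħ : ℂ)) • P) (𝓝[>] 0) (fun ħ : ℝ => ħ ^ 2) := by
    have hc : (fun ħ => -Complex.I * (f ħ : ℂ)) =O[𝓝[>] 0] (fun ħ : ℝ => ħ ^ 2) :=
      (Asymptotics.IsBigO.of_bound 1 (Filter.Eventually.of_forall fun ħ => by simp)).trans hf.isBigO
    have hP : SchwartzIsBigO (fun _ : ℝ => P) (𝓝[>] 0) (fun _ => 1) :=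
      SchwartzIsBigO.of_bounded fun i j => ⟨_, Filter.Eventually.of_forall fun _ => le_rfl⟩
    simpa using SchwartzIsBigO.smul hc hP
  exact SchwartzIsBigO.sum fun k _ => SchwartzIsBigO.sum fun j _ =>
    (key (hΘ j k) _).add (key (hN j k) _)

theorem omegaStar_commutator {ħ : ℝ} (hħ : 0 < ħ) {Θ N : Matrix (Fin n) (Fin n) ℝ}
    (hΘ : Θ.transpose = -Θ) (hN : N.transpose = -N) (hdet : (omegaMatrix ħ Θ N).det ≠ 0)
    (a b : 𝓢(PhaseSpace n, ℂ)) (z : PhaseSpace n) :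
    omegaStar ħ (omegaMatrix ħ Θ N) a b z - omegaStar ħ (omegaMatrix ħ Θ N) b a z =
      Complex.I * ħ * poissonBracket a b z + blockRemainder Θ N a b z +
        (ħ : ℂ) ^ 2 * (starRemainder a b (phaseSpaceMap (omegaMatrix ħ Θ N), ħ) z -
          starRemainder b a (phaseSpaceMap (omegaMatrix ħ Θ N), ħ) z) := by
  have hħ' : (ħ : ℂ) ≠ 0 := by exact_mod_cast hħ.ne'
  rw [omegaStar_sub_omegaStar hdet (transpose_omegaMatrix hΘ hN) hħ, sum_omegaMatrix_mul]
  congr 1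
  rw [mul_add, neg_mul_neg]
  congr 1
  rw [← mul_assoc, neg_mul, mul_assoc Complex.I, mul_inv_cancel₀ hħ', mul_one, Finset.mul_sum]
  simp only [blockRemainder, sum_apply, add_apply, smul_apply, derivProduct_apply, smul_eq_mul]
  refine Finset.sum_congr rfl fun k _ => ?_
  rw [Finset.mul_sum]
  refine Finset.sum_congr rfl fun j _ => ?_
  ring

end

/-! ### The semiclassical limit -/

theorem mainTheorem5 (n : ℕ) (Θ N : ℝ → Matrix (Fin n) (Fin n) ℝ)
    (hΘ : ∀ ħ : ℝ, 0 < ħ → (Θ ħ).transpose = -Θ ħ)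
    (hN : ∀ ħ : ℝ, 0 < ħ → (N ħ).transpose = -N ħ)
    (hΘo : ∀ α β, (fun ħ : ℝ => Θ ħ α β) =o[𝓝[>] 0] (fun ħ : ℝ => ħ ^ 2))
    (hNo : ∀ α β, (fun ħ : ℝ => N ħ α β) =o[𝓝[>] 0] (fun ħ : ℝ => ħ ^ 2))
    (a b : 𝓢(PhaseSpace n, ℂ)) :
    (∀ᶠ ħ : ℝ in 𝓝[>] 0,
      IsUnit (omegaMatrix ħ (Θ ħ) (N ħ)) ∧
      StarConverges ħ (omegaMatrix ħ (Θ ħ) (N ħ)) a b ∧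
      StarConverges ħ (omegaMatrix ħ (Θ ħ) (N ħ)) b a) ∧
    ∃ R : ℝ → 𝓢(PhaseSpace n, ℂ),
      (∀ᶠ ħ : ℝ in 𝓝[>] 0, ∀ z : PhaseSpace n,
        omegaStar ħ (omegaMatrix ħ (Θ ħ) (N ħ)) a b z -
            omegaStar ħ (omegaMatrix ħ (Θ ħ) (N ħ)) b a z =
          Complex.I * (ħ : ℂ) * poissonBracket a b z + R ħ z) ∧
      ∀ k l : ℕ,
        (fun ħ : ℝ => SchwartzMap.seminorm ℝ k l (R ħ)) =O[𝓝[>] 0] (fun ħ : ℝ => ħ ^ 2) := by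
  have hΩ := tendsto_omegaMatrix hΘo hNo
  have hpos : ∀ᶠ ħ : ℝ in 𝓝[>] 0, 0 < ħ := self_mem_nhdsWithin
  have hdet : ∀ᶠ ħ in 𝓝[>] 0, (omegaMatrix ħ (Θ ħ) (N ħ)).det ≠ 0 :=
    ((continuous_id.matrix_det.tendsto _).comp hΩ).eventually_ne det_fromBlocks_standard_ne_zero
  let p : ℝ → (PhaseSpace n →L[ℝ] PhaseSpace n) × ℝ :=
    fun ħ => (phaseSpaceMap (omegaMatrix ħ (Θ ħ) (N ħ)), ħ)
  have hp : Filter.Tendsto p (𝓝[>] 0) (𝓝 (phaseSpaceMap (Matrix.fromBlocks 0 1 (-1) 0), 0)) :=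
    ((continuous_phaseSpaceMap.tendsto _).comp hΩ).prodMk_nhds
      (tendsto_nhdsWithin_of_tendsto_nhds Filter.tendsto_id)
  -- Convergence of `(Ω, ħ)` supplies the bounded parameter range required for uniform remainder
  -- estimates.
  obtain ⟨r, hr⟩ : ∃ r, ∀ᶠ ħ in 𝓝[>] 0, ‖p ħ‖ ≤ r :=
    ⟨_, (hp.norm.eventually_lt_const (lt_add_one _)).mono fun _ h => h.le⟩
  have hconv (ħ : ℝ) (hd : (omegaMatrix ħ (Θ ħ) (N ħ)).det ≠ 0) (c d : 𝓢(PhaseSpace n, ℂ)) :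
      StarConverges ħ (omegaMatrix ħ (Θ ħ) (N ħ)) c d := fun z =>
    integrable_weylIntegrand_affine (L := phaseSpaceMap (omegaMatrix ħ (Θ ħ) (N ħ)))
      (by rwa [det_phaseSpaceMap]) ħ c d z
  refine ⟨?_, fun ħ => blockRemainder (Θ ħ) (N ħ) a b + (ħ : ℂ) ^ 2 •
    (starRemainder a b (p ħ) + (-1 : ℂ) • starRemainder b a (p ħ)), ?_, ?_⟩
  · filter_upwards [hdet] with ħ hd
    exact ⟨(Matrix.isUnit_iff_isUnit_det _).mpr hd.isUnit, hconv ħ hd a b, hconv ħ hd b a⟩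
  · filter_upwards [hdet, hpos] with ħ hd hħ z
    rw [omegaStar_commutator hħ (hΘ ħ hħ) (hN ħ hħ) hd]
    simp only [add_apply, smul_apply, smul_eq_mul, p]
    ring
  · have h1 := schwartzIsBigO_starRemainder a b hr
    have h2 := schwartzIsBigO_starRemainder b a hr
    have h3 : SchwartzIsBigO (fun ħ => (-1 : ℂ) • starRemainder b a (p ħ)) (𝓝[>] 0)
        (fun _ => 1) := by
      simpa using SchwartzIsBigO.smul (Asymptotics.isBigO_const_const (-1 : ℂ) one_ne_zero _) h2
    have hsq : (fun ħ : ℝ => (ħ : ℂ) ^ 2) =O[𝓝[>] 0] (fun ħ : ℝ => ħ ^ 2) :=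
      Asymptotics.IsBigO.of_bound 1 (Filter.Eventually.of_forall fun ħ => by simp)
    have h4 := SchwartzIsBigO.smul hsq (h1.add h3)
    simp only [mul_one] at h4
    exact (schwartzIsBigO_blockRemainder hΘo hNo a b).add h4
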